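/- **Proposition (cross representations pass to $\mathcal A\rtimes_\iota\hat G$).** Let $G$ be a locally compact (Hausdorff) abelian group with Pontryagin dual $\hat G$, let $\mathcal A$ be a C*-algebra, and let $\alpha: G\to\mathrm{Aut}(\mathcal A)$ be a group homomorphism, with no continuity assumed (a C*-action $(\mathcal A,G,\alpha)$). A covariant representation $(\pi,U)$ of $(\mathcal A,G,\alpha)$ on a Hilbert space $\mathcal H$ consists of a non-degenerate representation $\pi$ of $\mathcal A$ and a strongly continuous unitary representation $U$ of $G$ on $\mathcal H$ with $U_g\pi(a)U_g^*=\pi(\alpha_g(a))$ for all $g\in G$, $a\in\mathcal A$. Put $\mathcal L=C^*(G)$, and let $U_{\mathcal L}:\mathcal L\to B(\mathcal H)$ be the representation with $U_{\mathcal L}(f)=\int_G f(g)U_g\,dg$ for $f\in C_c(G)$. The pair $(\pi,U)$ is called *cross* if there is an approximate identity $(E_j)$ of $\mathcal L$, with $\|E_j\|\le 1$, such that $\|U_{\mathcal L}(E_j)\pi(a)U_{\mathcal L}(x)-\pi(a)U_{\mathcal L}(x)\|\to 0$ for all $a\in\mathcal A$ and $x\in\mathcal L$. Let $\mathcal A\rtimes_\iota\hat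 G$ be the crossed product of $\mathcal A$ by the trivial action $\iota$ of $\hat G$, and let $\beta$ be the action of $G$ on $\mathcal A\rtimes_\iota\hat G$ determined by $(\beta_g f)(\gamma)=\langle g,\gamma\rangle\,\alpha_g(f(\gamma))$ for $f\in C_c(\hat G,\mathcal A)$. Let $(\pi,U)$ be a cross covariant representation of $(\mathcal A,G,\alpha)$ on $\mathcal H$. Let $V$ be a strongly continuous unitary representation of $\hat G$ on $\mathcal H$ such that $(\pi,V)$ is a covariant representation of $(\mathcal A,\hat G,\iota)$, i.e. every $V_\gamma$ commutes with $\pi(\mathcal A)$, and let $\pi\rtimes V$ be the representation of $\mathcal A\rtimes_\iota\hat G$ with $(\pi\rtimes V)(f)=\int_{\hat G}\pi(f(\gamma))V_\gamma\,d\gamma$ for $f\in C_c(\hat G,\mathcal A)$. Then: 1. $(\pi\rtimes V,U)$ is a covariant representation of the C*-action $(\mathcal A\rtimes_\iota\hat G,G,\beta)$ if and only if $U_gV_\gamma U_g^*=\langle g,\gamma\rangle V_\gamma$ for all $g\in G$, $\gamma\in\hat G$. 2. If $(\pi\rtimes V,U)$ is a covariant representation of $(\mathcal A\rtimes_\iota\hat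 G,G,\beta)$, then it is also cross. -/

import Mathlib

set_option linter.unusedSectionVars false

/-- A complex `*`-algebra with a submultiplicative seminorm satisfying the C⋆-identity. -/
class PreCStarAlgebra (E : Type*) extends NonUnitalSeminormedRing E, StarRing E,
    NormedSpace ℂ E, IsScalarTower ℂ E E, SMulCommClass ℂ E E, StarModule ℂ E where
  norm_star_mul_self' : ∀ x : E, ‖star x * x‖ = ‖x‖ * ‖x‖

/-- The C⋆-algebra obtained from a `*`-algebra with a C⋆-seminorm by separation and completion. -/
def CStarCompletion (E : Type*) [PreCStarAlgebra E] : Type _ := UniformSpace.Completion E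

namespace CStarCompletion

open UniformSpace

section

variable {E : Type*} [PreCStarAlgebra E]

theorem pre_norm_star (x : E) : ‖star x‖ = ‖x‖ := by
  have key : ∀ y : E, ‖y‖ ≤ ‖star y‖ := by
    intro y
    have h1 := PreCStarAlgebra.norm_star_mul_self' y
    have h2 := norm_mul_le (star y) y
    rcases (norm_nonneg y).eq_or_lt with h | h
    · rw [← h]; exact norm_nonneg _
    · exact le_of_mul_le_mul_right (h1 ▸ h2) h
  exact le_antisymm (by simpa using key (star x)) (key x)

noncomputable instance : NormedAddCommGroup (CStarCompletion E) :=
  inferInstanceAs (NormedAddCommGroup (Completion E))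

noncomputable instance : NormedSpace ℂ (CStarCompletion E) :=
  inferInstanceAs (NormedSpace ℂ (Completion E))

instance : CompleteSpace (CStarCompletion E) :=
  inferInstanceAs (CompleteSpace (Completion E))

/-- The canonical map of a `*`-algebra into its completion. -/
def of : E → CStarCompletion E := fun x => (x : Completion E)

theorem isDenseInducing_of : IsDenseInducing (of : E → CStarCompletion E) :=
  Completion.isDenseInducing_coe

theorem isUniformInducing_of : IsUniformInducing (of : E → CStarCompletion E) :=
  Completion.isUniformInducing_coe E

theorem continuous_of : Continuous (of : E → CStarCompletion E) :=
  Completion.continuous_coe E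

theorem of_add (x y : E) : of (x + y) = of x + of y := Completion.coe_add x y

theorem of_smul (c : ℂ) (x : E) : of (c • x) = c • of x := Completion.coe_smul c x

theorem of_zero : of (0 : E) = 0 := rfl

theorem norm_of (x : E) : ‖of x‖ = ‖x‖ := Completion.norm_coe x

@[elab_as_elim]
theorem induction_on {p : CStarCompletion E → Prop} (a : CStarCompletion E)
    (hp : IsClosed {a | p a}) (ih : ∀ x : E, p (of x)) : p a :=
  Completion.induction_on (p := p) a hp ih

@[elab_as_elim]
theorem induction_on₂ {p : CStarCompletion E → CStarCompletion E → Prop}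
    (a b : CStarCompletion E)
    (hp : IsClosed {x : CStarCompletion E × CStarCompletion E | p x.1 x.2})
    (ih : ∀ x y : E, p (of x) (of y)) : p a b :=
  Completion.induction_on₂ (p := p) a b hp ih

@[elab_as_elim]
theorem induction_on₃ {p : CStarCompletion E → CStarCompletion E → CStarCompletion E → Prop}
    (a b c : CStarCompletion E)
    (hp : IsClosed {x : CStarCompletion E × CStarCompletion E × CStarCompletion E |
      p x.1 x.2.1 x.2.2})
    (ih : ∀ x y z : E, p (of x) (of y) (of z)) : p a b c :=
  Completion.induction_on₃ (p := p) a b c hp ih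

/-- The canonical map as a homomorphism of additive groups. -/
def ofHom : E →+ CStarCompletion E where
  toFun := of
  map_zero' := of_zero
  map_add' := of_add

/-- The product on the completion, the continuous extension of the product. -/
noncomputable instance : Mul (CStarCompletion E) :=
  ⟨Function.curry <| (isDenseInducing_of.prodMap isDenseInducing_of).extend
    (of ∘ Function.uncurry (· * · : E → E → E))⟩

theorem of_mul (x y : E) : of (x * y) = of x * of y :=
  ((isDenseInducing_of.prodMap isDenseInducing_of).extend_eq
    (continuous_of.comp continuous_mul) (x, y)).symm

instance : ContinuousMul (CStarCompletion E) where
  continuous_mul := by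
    let m := (AddMonoidHom.mul : E →+ E →+ E).compr₂ ofHom
    have : Continuous fun p : E × E => m p.1 p.2 := continuous_of.comp continuous_mul
    have di : IsDenseInducing (ofHom : E → CStarCompletion E) := isDenseInducing_of
    exact (di.extend_Z_bilin di this :)

/-- The involution on the completion, the continuous extension of the involution. -/
noncomputable instance : Star (CStarCompletion E) :=
  ⟨isDenseInducing_of.extend (of ∘ (star : E → E))⟩

theorem pre_continuous_star : Continuous (star : E → E) :=
  AddMonoidHomClass.continuous_of_bound (starAddEquiv : E ≃+ E) 1
    (fun x => by simp [pre_norm_star])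

theorem of_star (x : E) : of (star x) = star (of x) :=
  (isDenseInducing_of.extend_eq (continuous_of.comp pre_continuous_star) x).symm

theorem completion_continuous_star : Continuous (star : CStarCompletion E → CStarCompletion E) := by
  have h : UniformContinuous (of ∘ (star : E → E)) :=
    (isUniformInducing_of.uniformContinuous).comp
      (uniformContinuous_of_continuousAt_zero (starAddEquiv : E ≃+ E)
        pre_continuous_star.continuousAt)
  exact (uniformContinuous_uniformly_extend isUniformInducing_of
    isDenseInducing_of.dense h).continuous

noncomputable instance : NonUnitalNormedRing (CStarCompletion E) :=
  { (inferInstance : NormedAddCommGroup (CStarCompletion E)),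
    (inferInstance : Mul (CStarCompletion E)) with
    zero_mul := fun a => induction_on a (isClosed_eq (by fun_prop) continuous_const)
      fun a => by rw [← of_zero, ← of_mul, zero_mul]
    mul_zero := fun a => induction_on a (isClosed_eq (by fun_prop) continuous_const)
      fun a => by rw [← of_zero, ← of_mul, mul_zero]
    mul_assoc := fun a b c => induction_on₃ a b c (isClosed_eq (by fun_prop) (by fun_prop))
      fun a b c => by rw [← of_mul, ← of_mul, ← of_mul, ← of_mul, mul_assoc]
    left_distrib := fun a b c => induction_on₃ a b c (isClosed_eq (by fun_prop) (by fun_prop))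
      fun a b c => by rw [← of_add, ← of_mul, ← of_mul, ← of_mul, ← of_add, mul_add]
    right_distrib := fun a b c => induction_on₃ a b c (isClosed_eq (by fun_prop) (by fun_prop))
      fun a b c => by rw [← of_add, ← of_mul, ← of_mul, ← of_mul, ← of_add, add_mul]
    norm_mul_le := fun a b => induction_on₂ a b (isClosed_le (by fun_prop) (by fun_prop))
      fun a b => by rw [← of_mul, norm_of, norm_of, norm_of]; exact norm_mul_le a b }

noncomputable instance : StarRing (CStarCompletion E) where
  star_involutive := fun a => induction_on a
    (isClosed_eq (completion_continuous_star.comp completion_continuous_star) continuous_id)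
    fun a => by rw [← of_star, ← of_star, star_star]
  star_mul := fun a b => induction_on₂ a b
    (isClosed_eq (completion_continuous_star.comp (continuous_fst.mul continuous_snd))
      ((completion_continuous_star.comp continuous_snd).mul
        (completion_continuous_star.comp continuous_fst)))
    fun a b => by rw [← of_mul, ← of_star, ← of_star, ← of_star, ← of_mul, star_mul]
  star_add := fun a b => induction_on₂ a b
    (isClosed_eq (completion_continuous_star.comp (continuous_fst.add continuous_snd))
      ((completion_continuous_star.comp continuous_fst).add
        (completion_continuous_star.comp continuous_snd)))
    fun a b => by rw [← of_add, ← of_star, ← of_star, ← of_star, ← of_add, star_add]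

noncomputable instance : NonUnitalCStarAlgebra (CStarCompletion E) :=
  { (inferInstance : NonUnitalNormedRing (CStarCompletion E)),
    (inferInstance : StarRing (CStarCompletion E)),
    (inferInstance : CompleteSpace (CStarCompletion E)),
    (inferInstance : NormedSpace ℂ (CStarCompletion E)) with
    norm_mul_self_le := fun a => induction_on a
      (isClosed_le (by fun_prop)
        ((completion_continuous_star.mul continuous_id).norm))
      fun a => by
        rw [← of_star, ← of_mul, norm_of, norm_of, PreCStarAlgebra.norm_star_mul_self']
    smul_assoc := fun c a b => induction_on₂ a b (isClosed_eq
        ((continuous_fst.const_smul c).mul continuous_snd)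
        ((continuous_fst.mul continuous_snd).const_smul c))
      fun a b => by
        simp only [smul_eq_mul]
        rw [← of_smul, ← of_mul, ← of_mul, ← of_smul, smul_mul_assoc]
    smul_comm := fun c a b => induction_on₂ a b (isClosed_eq
        ((continuous_fst.mul continuous_snd).const_smul c)
        (continuous_fst.mul (continuous_snd.const_smul c)))
      fun a b => by
        simp only [smul_eq_mul]
        rw [← of_smul, ← of_mul, ← of_mul, ← of_smul, mul_smul_comm]
    star_smul := fun c a => induction_on a (isClosed_eq
        (completion_continuous_star.comp (continuous_id.const_smul c))
        (completion_continuous_star.const_smul (star c)))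
      fun a => by rw [← of_smul, ← of_star, ← of_star, ← of_smul, star_smul] }

variable {B : Type*} [NonUnitalCStarAlgebra B]

theorem uniformContinuous_pre (φ : E →⋆ₙₐ[ℂ] B) (hφ : ∀ x, ‖φ x‖ ≤ ‖x‖) :
    UniformContinuous φ :=
  (AddMonoidHomClass.lipschitz_of_bound φ 1 (by simpa using hφ)).uniformContinuous

/-- The extension of a contractive `*`-homomorphism to the completion. -/
noncomputable def lift (φ : E →⋆ₙₐ[ℂ] B) (hφ : ∀ x, ‖φ x‖ ≤ ‖x‖) :
    CStarCompletion E →⋆ₙₐ[ℂ] B :=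
  have hc : Continuous (isDenseInducing_of.extend φ : CStarCompletion E → B) :=
    (uniformContinuous_uniformly_extend isUniformInducing_of
      isDenseInducing_of.dense (uniformContinuous_pre φ hφ)).continuous
  have he : ∀ x : E, (isDenseInducing_of.extend φ : CStarCompletion E → B) (of x) = φ x :=
    fun x => isDenseInducing_of.extend_eq (uniformContinuous_pre φ hφ).continuous x
  { toFun := isDenseInducing_of.extend φ
    map_smul' := fun c a => induction_on a (isClosed_eq (hc.comp (continuous_id.const_smul c))
      (hc.const_smul c)) fun a => by
        rw [← of_smul, he, he, map_smul, MonoidHom.id_apply]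
    map_zero' := by rw [← of_zero, he, map_zero]
    map_add' := fun a b => induction_on₂ a b (isClosed_eq
      (hc.comp (continuous_fst.add continuous_snd))
      ((hc.comp continuous_fst).add (hc.comp continuous_snd)))
      fun a b => by rw [← of_add, he, he, he, map_add]
    map_mul' := fun a b => induction_on₂ a b (isClosed_eq
      (hc.comp (continuous_fst.mul continuous_snd))
      ((hc.comp continuous_fst).mul (hc.comp continuous_snd)))
      fun a b => by rw [← of_mul, he, he, he, map_mul]
    map_star' := fun a => induction_on a (isClosed_eq (hc.comp completion_continuous_star)
      (continuous_star.comp hc)) fun a => by rw [← of_star, he, he, map_star] }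

theorem lift_of (φ : E →⋆ₙₐ[ℂ] B) (hφ : ∀ x, ‖φ x‖ ≤ ‖x‖) (x : E) :
    lift φ hφ (of x) = φ x :=
  isDenseInducing_of.extend_eq (uniformContinuous_pre φ hφ).continuous x

/-- The canonical map of a `*`-algebra into its completion, as a `*`-homomorphism. -/
noncomputable def ofStarHom : E →⋆ₙₐ[ℂ] CStarCompletion E where
  toFun := of
  map_smul' := of_smul
  map_zero' := of_zero
  map_add' := of_add
  map_mul' := of_mul
  map_star' := of_star

end

end CStarCompletion

open MeasureTheory

/-- The space `C_c(K, A)` of continuous compactly supported functions on a locally compact abelian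
group `K` with values in a C⋆-algebra `A`. It is a type synonym, so that it can carry the
convolution product rather than the pointwise one. -/
def ConvAlg (K A : Type*) [TopologicalSpace K] [NonUnitalCStarAlgebra A] : Type _ :=
  CompactlySupportedContinuousMap K A

namespace ConvAlg

section Basic

variable {K A : Type*} [TopologicalSpace K] [NonUnitalCStarAlgebra A]

noncomputable instance : AddCommGroup (ConvAlg K A) :=
  inferInstanceAs (AddCommGroup (CompactlySupportedContinuousMap K A))

noncomputable instance : Module ℂ (ConvAlg K A) :=
  inferInstanceAs (Module ℂ (CompactlySupportedContinuousMap K A))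

instance : FunLike (ConvAlg K A) K A :=
  inferInstanceAs (FunLike (CompactlySupportedContinuousMap K A) K A)

@[ext]
theorem ext {f g : ConvAlg K A} (h : ∀ t, f t = g t) : f = g := DFunLike.ext _ _ h

/-- The element of `C_c(K, A)` given by a continuous compactly supported function. -/
def mk (f : K → A) (hf : Continuous f) (hc : HasCompactSupport f) : ConvAlg K A :=
  (⟨⟨f, hf⟩, hc⟩ : CompactlySupportedContinuousMap K A)

@[simp] theorem mk_apply (f : K → A) (hf : Continuous f) (hc : HasCompactSupport f) (t : K) :
    mk f hf hc t = f t := rfl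

@[simp] theorem add_apply (f g : ConvAlg K A) (t : K) : (f + g) t = f t + g t := rfl

@[simp] theorem zero_apply (t : K) : (0 : ConvAlg K A) t = 0 := rfl

@[simp] theorem neg_apply (f : ConvAlg K A) (t : K) : (-f) t = -f t := rfl

@[simp] theorem smul_apply (c : ℂ) (f : ConvAlg K A) (t : K) : (c • f) t = c • f t := rfl

@[fun_prop]
theorem continuous_coe (f : ConvAlg K A) : Continuous f :=
  map_continuous (show CompactlySupportedContinuousMap K A from f)

theorem hasCompactSupport (f : ConvAlg K A) : HasCompactSupport f :=
  CompactlySupportedContinuousMap.hasCompactSupport (f : CompactlySupportedContinuousMap K A)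

theorem apply_eq_zero (f : ConvAlg K A) {t : K} (ht : t ∉ tsupport f) : f t = 0 :=
  image_eq_zero_of_notMem_tsupport ht

variable [CommGroup K] [IsTopologicalGroup K]

/-- The involution `f*(t) = f(t⁻¹)*`. -/
noncomputable instance : Star (ConvAlg K A) :=
  ⟨fun f => mk (fun t => star (f t⁻¹)) (by fun_prop) (by
    have h1 : HasCompactSupport (fun t : K => f t⁻¹) :=
      f.hasCompactSupport.comp_homeomorph (Homeomorph.inv K)
    exact h1.comp_left (g := star) (star_zero A))⟩

theorem star_apply (f : ConvAlg K A) (t : K) : star f t = star (f t⁻¹) := rfl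

end Basic

section Convolution

variable {K A : Type*} [CommGroup K] [TopologicalSpace K] [IsTopologicalGroup K]
  [LocallyCompactSpace K] [MeasurableSpace K] [BorelSpace K]
  [NonUnitalCStarAlgebra A]

/-- A continuous function vanishing wherever an element of `C_c(K, A)` vanishes is integrable. -/
theorem integrable_of {E : Type*} [NormedAddCommGroup E] (f : ConvAlg K A) (F : K → E)
    (hF : Continuous F) (h : ∀ s, f s = 0 → F s = 0) : Integrable F (Measure.haar : Measure K) :=
  hF.integrable_of_hasCompactSupport (HasCompactSupport.intro f.hasCompactSupport
    fun s hs => h s (f.apply_eq_zero hs))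

theorem continuous_conv (f g : ConvAlg K A) :
    Continuous fun t : K => ∫ s, f s * g (s⁻¹ * t) ∂(Measure.haar : Measure K) := by
  rw [← continuousOn_univ]
  refine continuousOn_integral_of_compact_support (k := tsupport f) f.hasCompactSupport ?_ ?_
  · refine Continuous.continuousOn ?_
    simp only [Function.uncurry_def]
    fun_prop
  · intro p x _ hx
    rw [f.apply_eq_zero hx, zero_mul]

open scoped Pointwise in
theorem hasCompactSupport_conv (f g : ConvAlg K A) :
    HasCompactSupport fun t : K => ∫ s, f s * g (s⁻¹ * t) ∂(Measure.haar : Measure K) := by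
  refine HasCompactSupport.intro (K := tsupport f * tsupport g)
    (f.hasCompactSupport.isCompact.mul g.hasCompactSupport.isCompact) fun t ht => ?_
  refine integral_eq_zero_of_ae (Filter.Eventually.of_forall fun s => ?_)
  by_cases hs : s ∈ tsupport f
  · have : s⁻¹ * t ∉ tsupport g := fun h => ht ⟨s, hs, s⁻¹ * t, h, by simp⟩
    simp [g.apply_eq_zero this]
  · simp [f.apply_eq_zero hs]

/-- The convolution product `(f * g)(t) = ∫ f(s) g(s⁻¹ t) ds`, with respect to Haar measure. -/
noncomputable instance : Mul (ConvAlg K A) :=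
  ⟨fun f g => mk (fun t => ∫ s, f s * g (s⁻¹ * t) ∂(Measure.haar : Measure K))
    (continuous_conv f g) (hasCompactSupport_conv f g)⟩

theorem mul_apply (f g : ConvAlg K A) (t : K) :
    (f * g) t = ∫ s, f s * g (s⁻¹ * t) ∂(Measure.haar : Measure K) := rfl

theorem integrable_conv (f g : ConvAlg K A) (t : K) :
    Integrable (fun s => f s * g (s⁻¹ * t)) (Measure.haar : Measure K) :=
  integrable_of f _ (by fun_prop) fun s hs => by rw [hs, zero_mul]

theorem conv_assoc (f g h : ConvAlg K A) : f * g * h = f * (g * h) := by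
  ext t
  have e1 : ∀ s : K, (∫ r, f r * g (r⁻¹ * s) ∂(Measure.haar : Measure K)) * h (s⁻¹ * t)
      = ∫ r, f r * g (r⁻¹ * s) * h (s⁻¹ * t) ∂(Measure.haar : Measure K) := fun s =>
    (((ContinuousLinearMap.mul ℂ A).flip (h (s⁻¹ * t))).integral_comp_comm
      (integrable_conv f g s)).symm
  have e2 : ∀ r : K, f r * (∫ s, g s * h (s⁻¹ * (r⁻¹ * t)) ∂(Measure.haar : Measure K))
      = ∫ s, f r * g (r⁻¹ * s) * h (s⁻¹ * t) ∂(Measure.haar : Measure K) := fun r => by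
    have := ((ContinuousLinearMap.mul ℂ A) (f r)).integral_comp_comm
      (integrable_conv g h (r⁻¹ * t))
    simp only [ContinuousLinearMap.mul_apply'] at this
    rw [← this, ← integral_mul_left_eq_self (fun s => f r * g (r⁻¹ * s) * h (s⁻¹ * t)) r]
    refine integral_congr_ae (Filter.Eventually.of_forall fun s => ?_)
    simp [mul_assoc]
  simp only [mul_apply, e1, e2]
  refine integral_integral_swap_of_hasCompactSupport (by
    simp only [Function.uncurry_def]; fun_prop) ?_
  refine HasCompactSupport.intro
    (K := (fun p : K × K => (p.1 * p.2, p.1)) '' (tsupport f ×ˢ tsupport g))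
    ((f.hasCompactSupport.isCompact.prod g.hasCompactSupport.isCompact).image (by fun_prop)) ?_
  rintro ⟨s, r⟩ hsr
  by_cases hr : r ∈ tsupport f
  · have : r⁻¹ * s ∉ tsupport g := fun hs => hsr ⟨(r, r⁻¹ * s), ⟨hr, hs⟩, by simp⟩
    simp [g.apply_eq_zero this]
  · simp [f.apply_eq_zero hr]

theorem conv_star (f g : ConvAlg K A) : star (f * g) = star g * star f := by
  ext t
  have e := ((starL' ℝ : A ≃L[ℝ] A) : A →L[ℝ] A).integral_comp_comm (integrable_conv f g t⁻¹)
  simp only [ContinuousLinearEquiv.coe_coe, starL'_apply] at e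
  rw [star_apply, mul_apply, mul_apply, ← e,
    ← integral_mul_left_eq_self (fun s => star g s * star f (s⁻¹ * t)) t]
  refine integral_congr_ae (Filter.Eventually.of_forall fun s => ?_)
  simp [star_apply, mul_comm]

noncomputable instance : NonUnitalRing (ConvAlg K A) :=
  { (inferInstance : AddCommGroup (ConvAlg K A)), (inferInstance : Mul (ConvAlg K A)) with
    zero_mul := fun f => by ext t; simp [mul_apply]
    mul_zero := fun f => by ext t; simp [mul_apply]
    mul_assoc := conv_assoc
    left_distrib := fun f g h => by
      ext t
      simp only [mul_apply, add_apply, mul_add]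
      exact integral_add (integrable_conv f g t) (integrable_conv f h t)
    right_distrib := fun f g h => by
      ext t
      simp only [mul_apply, add_apply, add_mul]
      exact integral_add (integrable_conv f h t) (integrable_conv g h t) }

noncomputable instance : StarRing (ConvAlg K A) where
  star_involutive := fun f => by ext t; simp [star_apply]
  star_mul := conv_star
  star_add := fun f g => by ext t; simp [star_apply]

instance : StarModule ℂ (ConvAlg K A) where
  star_smul := fun c f => by ext t; simp [star_apply]

instance : IsScalarTower ℂ (ConvAlg K A) (ConvAlg K A) where
  smul_assoc := fun c f g => by
    ext t
    simp only [smul_eq_mul, mul_apply, smul_apply, smul_mul_assoc, integral_smul]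

instance : SMulCommClass ℂ (ConvAlg K A) (ConvAlg K A) where
  smul_comm := fun c f g => by
    ext t
    simp only [smul_eq_mul, mul_apply, smul_apply, mul_smul_comm, integral_smul]

/-- The `L¹`-norm `∫ ‖f(s)‖ ds`. -/
noncomputable def l1Norm (f : ConvAlg K A) : ℝ := ∫ s, ‖f s‖ ∂(Measure.haar : Measure K)

theorem l1Norm_nonneg (f : ConvAlg K A) : 0 ≤ l1Norm f := integral_nonneg fun _ => norm_nonneg _

/-- C⋆-seminorms on the `*`-algebra `C_c(K, A)` which are dominated by the `L¹`-norm. -/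
structure IsBoundedCStarSeminorm (p : ConvAlg K A → ℝ) : Prop where
  nonneg : ∀ f, 0 ≤ p f
  add_le : ∀ f g, p (f + g) ≤ p f + p g
  smul : ∀ (c : ℂ) f, p (c • f) = ‖c‖ * p f
  mul_le : ∀ f g, p (f * g) ≤ p f * p g
  star_mul_self : ∀ f, p (star f * f) = p f * p f
  le_l1Norm : ∀ f, p f ≤ l1Norm f

/-- The universal (maximal) C⋆-seminorm on `C_c(K, A)`: the largest C⋆-seminorm dominated by the
`L¹`-norm, i.e. the norm of the enveloping C⋆-algebra of `L¹(K, A)`. As the C⋆-seminorms dominated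
by the `L¹`-norm are the functions `f ↦ ‖ρ(f)‖` for the `L¹`-contractive `*`-representations `ρ`,
and these are the integrated forms of covariant representations, this is the usual supremum over
covariant representations (written without quantifying over Hilbert spaces). -/
noncomputable def universalNorm (f : ConvAlg K A) : ℝ :=
  ⨆ p : {p : ConvAlg K A → ℝ // IsBoundedCStarSeminorm p}, p.1 f

theorem isBoundedCStarSeminorm_zero :
    IsBoundedCStarSeminorm (fun _ : ConvAlg K A => (0 : ℝ)) where
  nonneg := by simp
  add_le := by simp
  smul := by simp
  mul_le := by simp
  star_mul_self := by simp
  le_l1Norm := l1Norm_nonneg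

instance : Nonempty {p : ConvAlg K A → ℝ // IsBoundedCStarSeminorm p} :=
  ⟨⟨_, isBoundedCStarSeminorm_zero⟩⟩

theorem bddAbove_universalNorm (f : ConvAlg K A) : BddAbove
    (Set.range fun p : {p : ConvAlg K A → ℝ // IsBoundedCStarSeminorm p} => p.1 f) :=
  ⟨l1Norm f, by rintro _ ⟨p, rfl⟩; exact p.2.le_l1Norm f⟩

theorem le_universalNorm {p : ConvAlg K A → ℝ} (hp : IsBoundedCStarSeminorm p)
    (f : ConvAlg K A) : p f ≤ universalNorm f :=
  le_ciSup (bddAbove_universalNorm f) ⟨p, hp⟩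

theorem isBoundedCStarSeminorm_universalNorm :
    IsBoundedCStarSeminorm (universalNorm : ConvAlg K A → ℝ) where
  nonneg f := le_universalNorm isBoundedCStarSeminorm_zero f
  add_le f g := ciSup_le fun p => (p.2.add_le f g).trans
    (add_le_add (le_universalNorm p.2 f) (le_universalNorm p.2 g))
  smul c f := by
    simp only [universalNorm]
    rw [Real.mul_iSup_of_nonneg (norm_nonneg c)]
    exact iSup_congr fun p => p.2.smul c f
  mul_le f g := ciSup_le fun p => (p.2.mul_le f g).trans
    (mul_le_mul (le_universalNorm p.2 f) (le_universalNorm p.2 g) (p.2.nonneg g)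
      (le_universalNorm isBoundedCStarSeminorm_zero f))
  star_mul_self f := by
    have h0 : 0 ≤ universalNorm f := le_universalNorm isBoundedCStarSeminorm_zero f
    have h1 : 0 ≤ universalNorm (star f * f) :=
      le_universalNorm isBoundedCStarSeminorm_zero _
    apply le_antisymm
    · refine ciSup_le fun p => ?_
      rw [p.2.star_mul_self]
      exact mul_self_le_mul_self (p.2.nonneg f) (le_universalNorm p.2 f)
    · have : universalNorm f ≤ Real.sqrt (universalNorm (star f * f)) := by
        refine ciSup_le fun p => Real.le_sqrt_of_sq_le ?_
        rw [sq, ← p.2.star_mul_self]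
        exact le_universalNorm p.2 _
      calc universalNorm f * universalNorm f
          ≤ Real.sqrt (universalNorm (star f * f)) * Real.sqrt (universalNorm (star f * f)) :=
            mul_self_le_mul_self h0 this
        _ = _ := Real.mul_self_sqrt h1
  le_l1Norm f := ciSup_le fun p => p.2.le_l1Norm f

theorem universalNorm_zero : universalNorm (0 : ConvAlg K A) = 0 := by
  have := isBoundedCStarSeminorm_universalNorm.smul (0 : ℂ) (0 : ConvAlg K A)
  simpa using this

theorem universalNorm_neg (f : ConvAlg K A) : universalNorm (-f) = universalNorm f := by
  have := isBoundedCStarSeminorm_universalNorm.smul (-1 : ℂ) f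
  simpa using this

/-- `C_c(K, A)` with convolution and the universal C⋆-seminorm. -/
noncomputable instance : PreCStarAlgebra (ConvAlg K A) :=
  { AddGroupSeminorm.toSeminormedAddCommGroup
      { toFun := universalNorm
        map_zero' := universalNorm_zero
        add_le' := isBoundedCStarSeminorm_universalNorm.add_le
        neg' := universalNorm_neg },
    (inferInstance : NonUnitalRing (ConvAlg K A)),
    (inferInstance : StarRing (ConvAlg K A)),
    (inferInstance : Module ℂ (ConvAlg K A)),
    (inferInstance : StarModule ℂ (ConvAlg K A)),
    (inferInstance : IsScalarTower ℂ (ConvAlg K A) (ConvAlg K A)),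
    (inferInstance : SMulCommClass ℂ (ConvAlg K A) (ConvAlg K A)) with
    norm_mul_le := isBoundedCStarSeminorm_universalNorm.mul_le
    norm_smul_le := fun c f => (isBoundedCStarSeminorm_universalNorm.smul c f).le
    norm_star_mul_self' := isBoundedCStarSeminorm_universalNorm.star_mul_self }

theorem norm_def (f : ConvAlg K A) : ‖f‖ = universalNorm f := rfl

end Convolution

end ConvAlg

/-- The crossed product `A ⋊_ι K` of a C⋆-algebra `A` by the trivial action `ι` of a locally compact
abelian group `K`: the enveloping C⋆-algebra of the convolution algebra, that is, the completion of
`C_c(K, A)` with respect to the universal C⋆-seminorm. -/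
abbrev TrivialCrossedProduct (K A : Type*) [CommGroup K] [TopologicalSpace K]
    [IsTopologicalGroup K] [LocallyCompactSpace K] [MeasurableSpace K] [BorelSpace K]
    [NonUnitalCStarAlgebra A] : Type _ :=
  CStarCompletion (ConvAlg K A)

/-- The (full) group C⋆-algebra `C⋆(K)` of a locally compact abelian group. -/
abbrev GroupCStarAlgebra (K : Type*) [CommGroup K] [TopologicalSpace K]
    [IsTopologicalGroup K] [LocallyCompactSpace K] [MeasurableSpace K] [BorelSpace K] : Type _ :=
  TrivialCrossedProduct K ℂ

/-- A strongly continuous unitary representation of a topological group on a Hilbert space. -/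
structure UnitaryRep (K H : Type*) [Group K] [TopologicalSpace K] [NormedAddCommGroup H]
    [InnerProductSpace ℂ H] [CompleteSpace H] where
  toMonoidHom : K →* unitary (H →L[ℂ] H)
  continuous' : ∀ ξ : H, Continuous fun k => (toMonoidHom k : H →L[ℂ] H) ξ

namespace UnitaryRep

variable {K H : Type*} [Group K] [TopologicalSpace K] [NormedAddCommGroup H]
  [InnerProductSpace ℂ H] [CompleteSpace H]

/-- The unitary operator `V k`. -/
noncomputable def op (V : UnitaryRep K H) (k : K) : H →L[ℂ] H := V.toMonoidHom k

noncomputable instance : CoeFun (UnitaryRep K H) (fun _ => K → H →L[ℂ] H) := ⟨op⟩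

theorem continuous_op (V : UnitaryRep K H) (ξ : H) : Continuous fun k => V k ξ :=
  V.continuous' ξ

theorem map_mul (V : UnitaryRep K H) (k l : K) : V (k * l) = V k * V l := by simp [op]

theorem map_one (V : UnitaryRep K H) : V 1 = 1 := by simp [op]

theorem star_apply (V : UnitaryRep K H) (k : K) : star (V k) = V k⁻¹ := by
  rw [op, op, ← Unitary.coe_star, Unitary.star_eq_inv, ← MonoidHom.map_inv]

theorem norm_apply (V : UnitaryRep K H) (k : K) (ξ : H) : ‖V k ξ‖ = ‖ξ‖ :=
  Unitary.norm_map (V.toMonoidHom k) ξ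

end UnitaryRep

/-- A covariant representation `(π, U)` of a C⋆-action `(A, G, α)` on a Hilbert space `H`: `π` is a
non-degenerate representation of `A`, `U` is a strongly continuous unitary representation of `G`,
and `U_g π(a) U_g* = π(α_g(a))`. No continuity of the action `α` is required. -/
structure IsCovariantRep {G A H : Type*} [Group G] [TopologicalSpace G] [NonUnitalCStarAlgebra A]
    [NormedAddCommGroup H] [InnerProductSpace ℂ H] [CompleteSpace H]
    (α : G →* (A ≃⋆ₐ[ℂ] A)) (π : A →⋆ₙₐ[ℂ] (H →L[ℂ] H)) (U : UnitaryRep G H) : Prop where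
  nondegenerate : (Submodule.span ℂ {η : H | ∃ a ξ, η = π a ξ}).topologicalClosure = ⊤
  covariant : ∀ g a, U g * π a * star (U g) = π (α g a)

section IntegratedForm

variable {K A H : Type*} [CommGroup K] [TopologicalSpace K] [IsTopologicalGroup K]
  [LocallyCompactSpace K] [MeasurableSpace K] [BorelSpace K] [NonUnitalCStarAlgebra A]
  [NormedAddCommGroup H] [InnerProductSpace ℂ H] [CompleteSpace H]

theorem continuous_integrand (π : A →⋆ₙₐ[ℂ] (H →L[ℂ] H)) (V : UnitaryRep K H)
    (f : ConvAlg K A) (ξ : H) : Continuous fun k => π (f k) (V k ξ) := by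
  have hπ : Continuous π := (AddMonoidHomClass.lipschitz_of_bound π 1 fun a => by
    simpa using NonUnitalStarAlgHom.norm_apply_le π a).continuous
  exact (hπ.comp f.continuous_coe).clm_apply (V.continuous_op ξ)

theorem integrable_integrand (π : A →⋆ₙₐ[ℂ] (H →L[ℂ] H)) (V : UnitaryRep K H)
    (f : ConvAlg K A) (ξ : H) :
    Integrable (fun k => π (f k) (V k ξ)) (Measure.haar : Measure K) :=
  ConvAlg.integrable_of f _ (continuous_integrand π V f ξ) fun k hk => by simp [hk]

/-- The operator `∫ π(f(k)) V_k dk` (a strong operator integral), for `f ∈ C_c(K, A)`. -/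
noncomputable def integratedOp (π : A →⋆ₙₐ[ℂ] (H →L[ℂ] H)) (V : UnitaryRep K H)
    (f : ConvAlg K A) : H →L[ℂ] H :=
  LinearMap.mkContinuous
    { toFun := fun ξ => ∫ k, π (f k) (V k ξ) ∂(Measure.haar : Measure K)
      map_add' := fun ξ η => by
        simp only [map_add]
        exact integral_add (integrable_integrand π V f ξ) (integrable_integrand π V f η)
      map_smul' := fun c ξ => by
        simp only [map_smul, RingHom.id_apply]
        exact integral_smul c _ }
    f.l1Norm fun ξ => by
      refine (norm_integral_le_integral_norm _).trans ?_
      rw [ConvAlg.l1Norm, ← integral_mul_const]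
      refine integral_mono (integrable_integrand π V f ξ).norm
        ((ConvAlg.integrable_of f _ f.continuous_coe.norm fun k hk => by simp [hk]).mul_const _)
        fun k => ?_
      calc ‖π (f k) (V k ξ)‖ ≤ ‖π (f k)‖ * ‖V k ξ‖ := ContinuousLinearMap.le_opNorm _ _
        _ ≤ ‖f k‖ * ‖ξ‖ := by
          rw [V.norm_apply]
          gcongr
          exact NonUnitalStarAlgHom.norm_apply_le π (f k)

theorem integratedOp_apply (π : A →⋆ₙₐ[ℂ] (H →L[ℂ] H)) (V : UnitaryRep K H)
    (f : ConvAlg K A) (ξ : H) :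
    integratedOp π V f ξ = ∫ k, π (f k) (V k ξ) ∂(Measure.haar : Measure K) := rfl

theorem norm_integratedOp_le (π : A →⋆ₙₐ[ℂ] (H →L[ℂ] H)) (V : UnitaryRep K H)
    (f : ConvAlg K A) : ‖integratedOp π V f‖ ≤ f.l1Norm :=
  LinearMap.mkContinuous_norm_le _ f.l1Norm_nonneg _

theorem commute_of_isCovariantRep {π : A →⋆ₙₐ[ℂ] (H →L[ℂ] H)} {V : UnitaryRep K H}
    (h : IsCovariantRep 1 π V) (k : K) (a : A) : V k * π a = π a * V k := by
  have h1 : V k * π a * star (V k) = π a := h.covariant k a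
  have h2 : star (V k) * V k = 1 := Unitary.coe_star_mul_self _
  calc V k * π a = V k * π a * (star (V k) * V k) := by rw [h2, mul_one]
    _ = V k * π a * star (V k) * V k := by simp only [mul_assoc]
    _ = π a * V k := by rw [h1]

theorem commute_apply_of_isCovariantRep {π : A →⋆ₙₐ[ℂ] (H →L[ℂ] H)} {V : UnitaryRep K H}
    (h : IsCovariantRep 1 π V) (k : K) (a : A) (ξ : H) : V k (π a ξ) = π a (V k ξ) :=
  DFunLike.congr_fun (commute_of_isCovariantRep h k a) ξ

theorem integratedOp_star {π : A →⋆ₙₐ[ℂ] (H →L[ℂ] H)} {V : UnitaryRep K H}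
    (h : IsCovariantRep 1 π V) (f : ConvAlg K A) :
    integratedOp π V (star f) = star (integratedOp π V f) := by
  rw [ContinuousLinearMap.star_eq_adjoint, ContinuousLinearMap.eq_adjoint_iff]
  intro ξ η
  rw [integratedOp_apply, integratedOp_apply,
    ← integral_inner (integrable_integrand π V f η) ξ, ← inner_conj_symm,
    ← integral_inner (integrable_integrand π V (star f) ξ) η, ← integral_conj,
    ← integral_inv_eq_self]
  refine integral_congr_ae (Filter.Eventually.of_forall fun k => ?_)
  simp only [inner_conj_symm, ConvAlg.star_apply, inv_inv, map_star]
  rw [← commute_apply_of_isCovariantRep h, ← V.star_apply,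
    ContinuousLinearMap.star_eq_adjoint, ContinuousLinearMap.star_eq_adjoint,
    ContinuousLinearMap.adjoint_inner_left, ContinuousLinearMap.adjoint_inner_left]

theorem integratedOp_mul {π : A →⋆ₙₐ[ℂ] (H →L[ℂ] H)} {V : UnitaryRep K H}
    (h : IsCovariantRep 1 π V) (f g : ConvAlg K A) :
    integratedOp π V (f * g) = integratedOp π V f * integratedOp π V g := by
  have hπ : Continuous π := (AddMonoidHomClass.lipschitz_of_bound π 1 fun a => by
    simpa using NonUnitalStarAlgHom.norm_apply_le π a).continuous
  ext ξ
  have e1 : ∀ t : K, π ((f * g) t) (V t ξ)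
      = ∫ s, π (f s) (π (g (s⁻¹ * t)) (V t ξ)) ∂(Measure.haar : Measure K) := fun t => by
    let L : A →L[ℂ] H :=
      { toFun := fun a => π a (V t ξ)
        map_add' := by simp
        map_smul' := by simp
        cont := hπ.clm_apply continuous_const }
    have := L.integral_comp_comm (ConvAlg.integrable_conv f g t)
    rw [ConvAlg.mul_apply]
    refine this.symm.trans ?_
    simp [L]
  have e2 : ∀ s : K, π (f s) (V s (integratedOp π V g ξ))
      = ∫ t, π (f s) (π (g (s⁻¹ * t)) (V t ξ)) ∂(Measure.haar : Measure K) := fun s => by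
    rw [integratedOp_apply,
      ← integral_mul_left_eq_self (fun t => π (f s) (π (g (s⁻¹ * t)) (V t ξ))) s]
    refine ((π (f s) * V s).integral_comp_comm (integrable_integrand π V g ξ)).symm.trans ?_
    refine integral_congr_ae (Filter.Eventually.of_forall fun t => ?_)
    simp only [mul_apply_eq_comp, inv_mul_cancel_left]
    rw [commute_apply_of_isCovariantRep h, V.map_mul]
    rfl
  rw [mul_apply_eq_comp, integratedOp_apply, integratedOp_apply π V f]
  simp only [e1, e2]
  refine integral_integral_swap_of_hasCompactSupport ?_ ?_
  · simp only [Function.uncurry_def]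
    refine (hπ.comp (f.continuous_coe.comp continuous_snd)).clm_apply
      ((hπ.comp (g.continuous_coe.comp (by fun_prop))).clm_apply
        ((V.continuous_op ξ).comp continuous_fst))
  · refine HasCompactSupport.intro
      (K := (fun p : K × K => (p.1 * p.2, p.1)) '' (tsupport f ×ˢ tsupport g))
      ((f.hasCompactSupport.isCompact.prod g.hasCompactSupport.isCompact).image (by fun_prop)) ?_
    rintro ⟨t, s⟩ hts
    by_cases hs : s ∈ tsupport f
    · have : s⁻¹ * t ∉ tsupport g := fun ht => hts ⟨(s, s⁻¹ * t), ⟨hs, ht⟩, by simp⟩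
      simp [g.apply_eq_zero this]
    · simp [f.apply_eq_zero hs]

/-- The integrated form on `C_c(K, A)`, as a `*`-homomorphism. -/
noncomputable def integratedPre {π : A →⋆ₙₐ[ℂ] (H →L[ℂ] H)} {V : UnitaryRep K H}
    (h : IsCovariantRep 1 π V) : ConvAlg K A →⋆ₙₐ[ℂ] (H →L[ℂ] H) where
  toFun := integratedOp π V
  map_smul' := fun c f => by
    ext ξ
    simp only [integratedOp_apply, ConvAlg.smul_apply, map_smul, MonoidHom.id_apply,
      smul_apply]
    exact integral_smul c _
  map_zero' := by ext ξ; simp [integratedOp_apply]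
  map_add' := fun f g => by
    ext ξ
    simp only [integratedOp_apply, ConvAlg.add_apply, map_add, add_apply]
    exact integral_add (integrable_integrand π V f ξ) (integrable_integrand π V g ξ)
  map_mul' := integratedOp_mul h
  map_star' := integratedOp_star h

theorem integratedPre_apply {π : A →⋆ₙₐ[ℂ] (H →L[ℂ] H)} {V : UnitaryRep K H}
    (h : IsCovariantRep 1 π V) (f : ConvAlg K A) : integratedPre h f = integratedOp π V f := rfl

theorem norm_integratedPre_le {π : A →⋆ₙₐ[ℂ] (H →L[ℂ] H)} {V : UnitaryRep K H}
    (h : IsCovariantRep 1 π V) (f : ConvAlg K A) : ‖integratedPre h f‖ ≤ ‖f‖ :=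
  ConvAlg.le_universalNorm (p := fun f => ‖integratedPre h f‖)
    { nonneg := fun _ => norm_nonneg _
      add_le := fun f g => by rw [map_add]; exact norm_add_le _ _
      smul := fun c f => by rw [map_smul, norm_smul]
      mul_le := fun f g => by rw [map_mul]; exact norm_mul_le _ _
      star_mul_self := fun f => by rw [map_mul, map_star, CStarRing.norm_star_mul_self]
      le_l1Norm := norm_integratedOp_le π V } f

/-- The integrated form `π ⋊ V` of a covariant representation `(π, V)` of `(A, K, ι)`, where `ι` is
the trivial action: the representation of `A ⋊_ι K` which is `f ↦ ∫ π(f(k)) V_k dk` on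
`C_c(K, A)`. -/
noncomputable def integratedForm {π : A →⋆ₙₐ[ℂ] (H →L[ℂ] H)} {V : UnitaryRep K H}
    (h : IsCovariantRep 1 π V) : TrivialCrossedProduct K A →⋆ₙₐ[ℂ] (H →L[ℂ] H) :=
  CStarCompletion.lift (integratedPre h) (norm_integratedPre_le h)

theorem integratedForm_of {π : A →⋆ₙₐ[ℂ] (H →L[ℂ] H)} {V : UnitaryRep K H}
    (h : IsCovariantRep 1 π V) (f : ConvAlg K A) :
    integratedForm h (CStarCompletion.of f) = integratedOp π V f :=
  CStarCompletion.lift_of _ _ f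

variable (H) in
/-- The representation of `ℂ` on `H` by scalars. -/
noncomputable def scalarRep : ℂ →⋆ₙₐ[ℂ] (H →L[ℂ] H) where
  toFun := fun c => c • 1
  map_smul' := fun c d => by simp [mul_smul]
  map_zero' := by simp
  map_add' := fun c d => add_smul c d 1
  map_mul' := fun c d => by simp [smul_smul, mul_comm]
  map_star' := fun c => by simp

theorem isCovariantRep_scalarRep (U : UnitaryRep K H) :
    IsCovariantRep (1 : K →* (ℂ ≃⋆ₐ[ℂ] ℂ)) (scalarRep H) U where
  nondegenerate := by
    refine eq_top_iff.2 fun ξ _ => Submodule.le_topologicalClosure _ ?_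
    exact Submodule.subset_span ⟨1, ξ, by simp [scalarRep]⟩
  covariant := fun k c => by
    have h2 : U k * star (U k) = 1 := Unitary.coe_mul_star_self _
    simp [scalarRep, h2]

/-- The representation `U_𝓛` of the group C⋆-algebra `𝓛 = C⋆(K)` determined by a unitary
representation `U` of `K`, that is, `f ↦ ∫ f(k) U_k dk` on `C_c(K)`. -/
noncomputable def groupAlgebraRep (U : UnitaryRep K H) :
    GroupCStarAlgebra K →⋆ₙₐ[ℂ] (H →L[ℂ] H) :=
  integratedForm (isCovariantRep_scalarRep U)

open Filter Topology in
/-- A covariant representation `(π, U)` of a C⋆-action `(A, G, α)` is *cross* (with respect to the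
host algebra `𝓛 = C⋆(G)`) if there is an approximate identity `(E_j)` of `𝓛` such that
`‖U_𝓛(E_j) π(a) U_𝓛(x) - π(a) U_𝓛(x)‖ → 0` for all `a ∈ A` and `x ∈ 𝓛`. Nets are replaced by
filters, and approximate identities are bounded by one. -/
def IsCross (π : A →⋆ₙₐ[ℂ] (H →L[ℂ] H)) (U : UnitaryRep K H) : Prop :=
  ∃ l : Filter (GroupCStarAlgebra K), l.IsApproximateUnit ∧ (∀ᶠ e in l, ‖e‖ ≤ 1) ∧
    ∀ (a : A) (x : GroupCStarAlgebra K),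
      Tendsto (fun e => ‖groupAlgebraRep U e * π a * groupAlgebraRep U x
        - π a * groupAlgebraRep U x‖) l (𝓝 0)

end IntegratedForm

section DualAction

variable {G A : Type*} [CommGroup G] [TopologicalSpace G] [IsTopologicalGroup G]
  [NonUnitalCStarAlgebra A]

theorem continuous_pairing (g : G) : Continuous fun γ : PontryaginDual G => (γ g : ℂ) := by
  have : Continuous fun γ : PontryaginDual G => γ g :=
    (ContinuousEvalConst.continuous_eval_const (F := G →ₜ* Circle) g)
  exact continuous_subtype_val.comp this

theorem pairing_mul (γ δ : PontryaginDual G) (g : G) : (γ * δ) g = γ g * δ g := rfl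

theorem pairing_inv (γ : PontryaginDual G) (g : G) : γ⁻¹ g = (γ g)⁻¹ := rfl

variable [LocallyCompactSpace G] [MeasurableSpace (PontryaginDual G)]
  [BorelSpace (PontryaginDual G)]

/-- The map `f ↦ (γ ↦ ⟨g, γ⟩ σ(f(γ)))` on `C_c(Ĝ, A)`, for `g ∈ G` and an automorphism `σ` of
`A`. -/
noncomputable def twist (g : G) (σ : A ≃⋆ₐ[ℂ] A) :
    ConvAlg (PontryaginDual G) A →⋆ₙₐ[ℂ] ConvAlg (PontryaginDual G) A where
  toFun f := ConvAlg.mk (fun γ => (γ g : ℂ) • σ (f γ))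
    ((continuous_pairing g).smul
      ((StarAlgEquiv.isometry σ).continuous.comp f.continuous_coe))
    (HasCompactSupport.intro f.hasCompactSupport fun γ hγ => by simp [f.apply_eq_zero hγ])
  map_smul' c f := by
    ext γ
    simp [smul_comm c]
  map_zero' := by ext γ; simp
  map_add' f h := by ext γ; simp
  map_mul' f h := by
    ext γ
    let L : A →L[ℂ] A :=
      { toFun := fun a => (γ g : ℂ) • σ a
        map_add' := by simp
        map_smul' := fun c a => by
          simp only [map_smul, RingHom.id_apply]
          exact smul_comm _ _ _
        cont := (StarAlgEquiv.isometry σ).continuous.const_smul _ }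
    have := L.integral_comp_comm (ConvAlg.integrable_conv f h γ)
    rw [ConvAlg.mk_apply, ConvAlg.mul_apply, ConvAlg.mul_apply]
    refine this.symm.trans ?_
    refine integral_congr_ae (Filter.Eventually.of_forall fun s => ?_)
    have e : (γ g : ℂ) = (s g : ℂ) * ((s⁻¹ * γ) g : ℂ) := by
      rw [← Circle.coe_mul, ← pairing_mul, mul_inv_cancel_left]
    change (γ g : ℂ) • σ (f s * h (s⁻¹ * γ))
      = ((s g : ℂ) • σ (f s)) * (((s⁻¹ * γ) g : ℂ) • σ (h (s⁻¹ * γ)))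
    rw [e, map_mul, smul_mul_smul_comm]
  map_star' f := by
    ext γ
    rw [ConvAlg.star_apply, ConvAlg.mk_apply, ConvAlg.mk_apply, ConvAlg.star_apply, star_smul,
      map_star, pairing_inv, Circle.coe_inv_eq_conj]
    simp

theorem twist_apply (g : G) (σ : A ≃⋆ₐ[ℂ] A) (f : ConvAlg (PontryaginDual G) A)
    (γ : PontryaginDual G) : twist g σ f γ = (γ g : ℂ) • σ (f γ) := rfl

theorem norm_twist_le (g : G) (σ : A ≃⋆ₐ[ℂ] A) (f : ConvAlg (PontryaginDual G) A) :
    ‖twist g σ f‖ ≤ ‖f‖ := by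
  refine ciSup_le fun p => ?_
  refine ConvAlg.le_universalNorm (p := fun f => p.1 (twist g σ f))
    { nonneg := fun _ => p.2.nonneg _
      add_le := fun f h => by rw [map_add]; exact p.2.add_le _ _
      smul := fun c f => by rw [map_smul]; exact p.2.smul _ _
      mul_le := fun f h => by rw [map_mul]; exact p.2.mul_le _ _
      star_mul_self := fun f => by rw [map_mul, map_star]; exact p.2.star_mul_self _
      le_l1Norm := fun f => (p.2.le_l1Norm _).trans_eq ?_ } f
  simp only [ConvAlg.l1Norm, twist_apply, norm_smul, Circle.norm_coe, one_mul,
    StarAlgEquiv.norm_map]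

theorem norm_of_twist_le (g : G) (σ : A ≃⋆ₐ[ℂ] A) (f : ConvAlg (PontryaginDual G) A) :
    ‖CStarCompletion.ofStarHom.comp (twist g σ) f‖ ≤ ‖f‖ :=
  (CStarCompletion.norm_of _).trans_le (norm_twist_le g σ f)

/-- The extension of `twist g σ` to `A ⋊_ι Ĝ`. -/
noncomputable def twistHom (g : G) (σ : A ≃⋆ₐ[ℂ] A) :
    TrivialCrossedProduct (PontryaginDual G) A →⋆ₙₐ[ℂ]
      TrivialCrossedProduct (PontryaginDual G) A :=
  CStarCompletion.lift (CStarCompletion.ofStarHom.comp (twist g σ)) (norm_of_twist_le g σ)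

theorem twistHom_of (g : G) (σ : A ≃⋆ₐ[ℂ] A) (f : ConvAlg (PontryaginDual G) A) :
    twistHom g σ (CStarCompletion.of f) = CStarCompletion.of (twist g σ f) :=
  CStarCompletion.lift_of _ _ f

theorem continuous_twistHom (g : G) (σ : A ≃⋆ₐ[ℂ] A) : Continuous (twistHom g σ) :=
  (AddMonoidHomClass.lipschitz_of_bound (twistHom g σ) 1 fun a => by
    simpa using NonUnitalStarAlgHom.norm_apply_le (twistHom g σ) a).continuous

theorem twistHom_one (x : TrivialCrossedProduct (PontryaginDual G) A) :
    twistHom (1 : G) 1 x = x :=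
  CStarCompletion.induction_on x (isClosed_eq (continuous_twistHom _ _) continuous_id) fun f => by
    rw [twistHom_of]
    congr 1
    ext γ
    simp [twist_apply]

theorem twistHom_mul (g h : G) (σ τ : A ≃⋆ₐ[ℂ] A)
    (x : TrivialCrossedProduct (PontryaginDual G) A) :
    twistHom (g * h) (σ * τ) x = twistHom g σ (twistHom h τ x) :=
  CStarCompletion.induction_on x (isClosed_eq (continuous_twistHom _ _)
    ((continuous_twistHom _ _).comp (continuous_twistHom _ _))) fun f => by
    rw [twistHom_of, twistHom_of, twistHom_of]
    congr 1
    ext γ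
    simp [twist_apply, smul_smul]

/-- The action `β` of `G` on `A ⋊_ι Ĝ` induced by an action `α` of `G` on `A`, which satisfies
`(β_g f)(γ) = ⟨g, γ⟩ α_g(f(γ))` for `f ∈ C_c(Ĝ, A)`. -/
noncomputable def dualizedAction (α : G →* (A ≃⋆ₐ[ℂ] A)) :
    G →* (TrivialCrossedProduct (PontryaginDual G) A ≃⋆ₐ[ℂ]
      TrivialCrossedProduct (PontryaginDual G) A) where
  toFun g :=
    { toFun := twistHom g (α g)
      invFun := twistHom g⁻¹ (α g⁻¹)
      left_inv := fun x => by
        rw [← twistHom_mul, ← map_mul, inv_mul_cancel, map_one, twistHom_one]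
      right_inv := fun x => by
        rw [← twistHom_mul, ← map_mul, mul_inv_cancel, map_one, twistHom_one]
      map_mul' := map_mul (twistHom g (α g))
      map_add' := map_add (twistHom g (α g))
      map_star' := map_star (twistHom g (α g))
      map_smul' := map_smul (twistHom g (α g)) }
  map_one' := StarAlgEquiv.ext fun x => by
    show twistHom 1 (α 1) x = x
    rw [map_one, twistHom_one]
  map_mul' g h := StarAlgEquiv.ext fun x => by
    show twistHom (g * h) (α (g * h)) x = twistHom g (α g) (twistHom h (α h) x)
    rw [map_mul, twistHom_mul]

theorem dualizedAction_of (α : G →* (A ≃⋆ₐ[ℂ] A)) (g : G) (f : ConvAlg (PontryaginDual G) A) :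
    dualizedAction α g (CStarCompletion.of f) = CStarCompletion.of (twist g (α g) f) :=
  twistHom_of g (α g) f

end DualAction

/-! Part 1. If `U g * V γ * star (U g) = (γ g) • V γ`, then moving `U g` through `∫ π(f γ) V_γ ξ dγ`
turns `π(f γ)` into `π(α g (f γ))` and produces the factor `γ g`. This is `β` on the dense algebra
`C_c(Ĝ, A)`, and continuity gives the rest. Conversely, covariance tested on the elementary tensors
`φ ⊗ a` says that all `φ`-weighted integrals of a continuous `H`-valued function of `γ` vanish, so
the function itself vanishes. Covariance of `(π, U)` then leaves `π(α g a)` applied to the defect of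
the commutation relation, and non-degeneracy of `π` removes `π(α g a)`.

Part 2. By part 1 the commutation relation holds, so `V_γ` moves past `U_𝓛(x)` at the price of
multiplying `x` by the character `γ⁻¹`. Hence `(π ⋊ V)(f) U_𝓛(x) = ∫ π(f γ) U_𝓛(γ⁻¹ x) V_γ dγ` for
`f` and `x` compactly supported. The cross condition for `(π, U)` says that `U_𝓛(E_j)` acts
asymptotically as a left unit, in norm, on each `T γ = π(f γ) U_𝓛(γ⁻¹ x)`. Now `T` is norm
continuous with compact support and the `U_𝓛(E_j)` are contractions, so the convergence is uniform
in `γ` and survives the integral, although the integral itself is only strong. General elements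
follow by density. The same approximate identity serves both pairs.

The load is carried by `eq_zero_of_forall_integral_smul_eq_zero` in part 1, and by
`apply_integratedOp_scalarRep` and `tendsto_norm_mul_sub_of_integral` in part 2. -/

open Filter Topology

/-! ### Test functions and asymptotic left units -/

/-- A continuous vector-valued function whose integrals against all continuous compactly supported
functions vanish is zero. -/
theorem eq_zero_of_forall_integral_smul_eq_zero {K H : Type*} [TopologicalSpace K] [RegularSpace K]
    [LocallyCompactSpace K] [MeasurableSpace K] [BorelSpace K] (μ : Measure K)
    [IsFiniteMeasureOnCompacts μ] [μ.IsOpenPosMeasure]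
    [NormedAddCommGroup H] [InnerProductSpace ℂ H] [CompleteSpace H]
    {F : K → H} (hF : Continuous F)
    (h : ∀ φ : K → ℂ, Continuous φ → HasCompactSupport φ → ∫ k, φ k • F k ∂μ = 0) (k₀ : K) :
    F k₀ = 0 := by
  by_contra hne
  obtain ⟨ψ, hψ1, -, hψc, hψ⟩ := exists_continuous_one_zero_of_isCompact
    (isCompact_singleton (x := k₀)) isClosed_empty (Set.disjoint_empty _)
  have hψ0 : ψ k₀ = 1 := hψ1 rfl
  have hc : Continuous fun k => inner ℂ (F k) (F k₀) := hF.inner continuous_const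
  -- The test function is the bump `ψ` times `⟪F k, F k₀⟫`. Pairing the vanishing integral with `F
  -- k₀` makes the integrand `ψ k * ‖⟪F k, F k₀⟫‖ ^ 2`, which is nonnegative and is positive at
  -- `k₀`.
  have hsupp : HasCompactSupport fun k => (ψ k : ℂ) * inner ℂ (F k) (F k₀) :=
    HasCompactSupport.intro hψc fun k hk => by simp [image_eq_zero_of_notMem_tsupport hk]
  have hcont : Continuous fun k => (ψ k : ℂ) * inner ℂ (F k) (F k₀) := by fun_prop
  have h0 := h _ hcont hsupp
  have hint : Integrable (fun k => ((ψ k : ℂ) * inner ℂ (F k) (F k₀)) • F k) μ :=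
    (hcont.smul hF).integrable_of_hasCompactSupport
      (HasCompactSupport.intro hψc fun k hk => by simp [image_eq_zero_of_notMem_tsupport hk])
  have h1 := integral_inner (𝕜 := ℂ) hint (F k₀)
  rw [h0, inner_zero_right] at h1
  have e : ∀ k, inner ℂ (F k₀) (((ψ k : ℂ) * inner ℂ (F k) (F k₀)) • F k)
      = ((ψ k * ‖inner ℂ (F k) (F k₀)‖ ^ 2 : ℝ) : ℂ) := fun k => by
    rw [inner_smul_right, ← inner_conj_symm (F k₀) (F k), mul_assoc, Complex.mul_conj']
    push_cast
    rfl
  simp only [e] at h1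
  rw [integral_complex_ofReal, Complex.ofReal_eq_zero] at h1
  refine h1.not_gt ?_
  refine Continuous.integral_pos_of_hasCompactSupport_nonneg_nonzero (x := k₀)
    (by fun_prop) (HasCompactSupport.intro hψc fun k hk => by
      simp [image_eq_zero_of_notMem_tsupport hk])
    (fun k => mul_nonneg (hψ k).1 (sq_nonneg _)) ?_
  simp [hψ0, hne]

/-- Pointwise convergence `P i * T k → T k` under contractions `P i` is uniform on compact sets. -/
theorem eventually_forall_norm_mul_sub_le {ι K B : Type*} [TopologicalSpace K]
    [NonUnitalNormedRing B] {l : Filter ι} {P : ι → B} (hP : ∀ᶠ i in l, ‖P i‖ ≤ 1) {T : K → B}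
    (hT : Continuous T) (h : ∀ k, Tendsto (fun i => ‖P i * T k - T k‖) l (𝓝 0))
    {s : Set K} (hs : IsCompact s) {ε : ℝ} (hε : 0 < ε) :
    ∀ᶠ i in l, ∀ k ∈ s, ‖P i * T k - T k‖ ≤ ε := by
  -- The claim passes to subsets and finite unions, so by compactness it is enough to find one
  -- neighbourhood of each point.
  refine hs.induction_on (p := fun s => ∀ᶠ i in l, ∀ k ∈ s, ‖P i * T k - T k‖ ≤ ε)
    (by simp) (fun s t hst ht => ht.mono fun i hi k hk => hi k (hst hk))
    (fun s t hs ht => (hs.and ht).mono fun i hi k hk => hk.elim (hi.1 k) (hi.2 k)) fun k _ => ?_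
  -- Replacing `T k'` by `T k` costs `ε / 3` twice, once under the contraction `P i`; the third `ε /
  -- 3` is the convergence at `k`.
  refine ⟨{k' | ‖T k' - T k‖ < ε / 3}, mem_nhdsWithin_of_mem_nhds ?_, ?_⟩
  · have : Tendsto (fun k' => ‖T k' - T k‖) (𝓝 k) (𝓝 0) := by
      simpa using ((hT.sub (continuous_const (y := T k))).norm).tendsto k
    exact this.eventually (gt_mem_nhds (by positivity))
  · filter_upwards [hP, (h k).eventually (gt_mem_nhds (by positivity : (0 : ℝ) < ε / 3))]
      with i hi hik k' hk'
    have hk' : ‖T k' - T k‖ < ε / 3 := hk'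
    have e : P i * T k' - T k' = P i * (T k' - T k) + (P i * T k - T k) - (T k' - T k) := by
      rw [mul_sub]; abel
    have h1 : ‖P i * (T k' - T k)‖ ≤ ‖T k' - T k‖ :=
      (norm_mul_le _ _).trans (mul_le_of_le_one_left (norm_nonneg _) hi)
    rw [e]
    refine (norm_sub_le _ _).trans ?_
    linarith [norm_add_le (P i * (T k' - T k)) (P i * T k - T k)]

/-- The elements `T` with `P i * T → T` in norm form a closed set if the `P i` are contractions. -/
theorem isClosed_setOf_tendsto_norm_mul_sub {ι B : Type*} [NonUnitalNormedRing B] {l : Filter ι}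
    {P : ι → B} (hP : ∀ᶠ i in l, ‖P i‖ ≤ 1) :
    IsClosed {T : B | Tendsto (fun i => ‖P i * T - T‖) l (𝓝 0)} := by
  refine isClosed_of_closure_subset fun T hT => ?_
  rw [Set.mem_ofPred_eq, Metric.tendsto_nhds]
  intro ε hε
  obtain ⟨S, hS, hTS⟩ := Metric.mem_closure_iff.1 hT (ε / 3) (by positivity)
  rw [dist_eq_norm] at hTS
  have hS : Tendsto (fun i => ‖P i * S - S‖) l (𝓝 0) := hS
  filter_upwards [hP, hS.eventually (gt_mem_nhds (by positivity : (0 : ℝ) < ε / 3))] with i hi hiS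
  have e : P i * T - T = P i * (T - S) + (P i * S - S) - (T - S) := by rw [mul_sub]; abel
  have h1 : ‖P i * (T - S)‖ ≤ ‖T - S‖ :=
    (norm_mul_le _ _).trans (mul_le_of_le_one_left (norm_nonneg _) hi)
  rw [dist_zero_right, norm_norm, e]
  refine (norm_sub_le _ _).trans_lt ?_
  linarith [norm_add_le (P i * (T - S)) (P i * S - S)]

/-! ### Strong integrals and non-degenerate representations -/

section Representations

variable {K A H : Type*} [CommGroup K] [TopologicalSpace K] [IsTopologicalGroup K]
  [LocallyCompactSpace K] [MeasurableSpace K] [BorelSpace K] [NonUnitalCStarAlgebra A]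
  [NormedAddCommGroup H] [InnerProductSpace ℂ H] [CompleteSpace H]

theorem continuous_nonUnitalStarAlgHom {A B : Type*} [NonUnitalCStarAlgebra A]
    [NonUnitalCStarAlgebra B] (φ : A →⋆ₙₐ[ℂ] B) : Continuous φ :=
  (AddMonoidHomClass.lipschitz_of_bound φ 1 fun a => by
    simpa using NonUnitalStarAlgHom.norm_apply_le φ a).continuous

/-- The elementary tensor `φ ⊗ a` in `C_c(K, A)`. -/
noncomputable def ConvAlg.tensor (φ : K → ℂ) (hφ : Continuous φ) (hc : HasCompactSupport φ)
    (a : A) : ConvAlg K A :=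
  ConvAlg.mk (fun k => φ k • a) (hφ.smul continuous_const) hc.smul_right

/-- If the operators `T k` vanish off a compact set and `P i * T k → T k` in norm for every `k`,
then the same holds for the strong integral `∫ T k V_k dk`. -/
theorem tendsto_norm_mul_sub_of_integral {ι : Type*} {l : Filter ι} {P : ι → H →L[ℂ] H}
    (hP : ∀ᶠ i in l, ‖P i‖ ≤ 1) (V : UnitaryRep K H) {T : K → H →L[ℂ] H} (hT : Continuous T)
    {s : Set K} (hs : IsCompact s) (hTs : ∀ k ∉ s, T k = 0)
    (h : ∀ k, Tendsto (fun i => ‖P i * T k - T k‖) l (𝓝 0)) {M : H →L[ℂ] H}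
    (hM : ∀ ξ, M ξ = ∫ k, T k (V k ξ) ∂(Measure.haar : Measure K)) :
    Tendsto (fun i => ‖P i * M - M‖) l (𝓝 0) := by
  rw [Metric.tendsto_nhds]
  intro ε hε
  have hc0 : 0 ≤ (Measure.haar : Measure K).real s := measureReal_nonneg
  set c := (Measure.haar : Measure K).real s with hc
  -- The `c + 1` keeps the denominator positive when `s` has measure zero; multiplying back by the
  -- measure `c` of `s` stays strictly below `ε`.
  have hpos : 0 < ε / (2 * (c + 1)) := by positivity
  filter_upwards [eventually_forall_norm_mul_sub_le hP hT h hs hpos] with i hi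
  have hint : ∀ ξ, Integrable (fun k => T k (V k ξ)) (Measure.haar : Measure K) := fun ξ =>
    (hT.clm_apply (V.continuous_op ξ)).integrable_of_hasCompactSupport
      (HasCompactSupport.intro hs fun k hk => by simp [hTs k hk])
  have key : ‖P i * M - M‖ ≤ ε / (2 * (c + 1)) * c := by
    refine ContinuousLinearMap.opNorm_le_bound _ (by positivity) fun ξ => ?_
    -- Bounding vector by vector reduces the operator norm to a norm integral over `s`, with `V k`
    -- isometric.
    have e : (P i * M - M) ξ
        = ∫ k in s, (P i * T k - T k) (V k ξ) ∂(Measure.haar : Measure K) := by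
      rw [setIntegral_eq_integral_of_forall_compl_eq_zero fun k hk => by simp [hTs k hk],
        sub_apply, mul_apply_eq_comp, hM, ← ContinuousLinearMap.integral_comp_comm _ (hint ξ),
        ← integral_sub ((P i).integrable_comp (hint ξ)) (hint ξ)]
      rfl
    rw [e]
    refine (norm_setIntegral_le_of_norm_le_const (C := ε / (2 * (c + 1)) * ‖ξ‖)
      hs.measure_lt_top fun k hk => ?_).trans_eq (by rw [← hc]; ring)
    refine (ContinuousLinearMap.le_opNorm _ _).trans ?_
    rw [V.norm_apply]
    exact mul_le_mul_of_nonneg_right (hi k hk) (norm_nonneg _)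
  rw [dist_zero_right, norm_norm]
  refine key.trans_lt ?_
  rw [div_mul_eq_mul_div, div_lt_iff₀ (by positivity)]
  nlinarith

theorem eq_zero_of_forall_inner_eq_zero {A : Type*} [NonUnitalCStarAlgebra A]
    {π : A →⋆ₙₐ[ℂ] (H →L[ℂ] H)}
    (hπ : (Submodule.span ℂ {η : H | ∃ a ξ, η = π a ξ}).topologicalClosure = ⊤) {ζ : H}
    (h : ∀ a ξ, inner ℂ (π a ξ) ζ = 0) : ζ = 0 := by
  have hsub : Submodule.span ℂ {η : H | ∃ a ξ, η = π a ξ} ≤ (ℂ ∙ ζ)ᗮ := by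
    refine Submodule.span_le.2 ?_
    rintro _ ⟨a, ξ, rfl⟩
    exact Submodule.mem_orthogonal_singleton_iff_inner_left.2 (h a ξ)
  have hcl := Submodule.topologicalClosure_minimal _ hsub (Submodule.isClosed_orthogonal _)
  rw [hπ] at hcl
  exact inner_self_eq_zero.1 (Submodule.mem_orthogonal_singleton_iff_inner_left.1
    (hcl (Submodule.mem_top (x := ζ))))

/-- Since `π` preserves adjoints, a vector killed by all of `π(A)` is orthogonal to its range, and
the span of that range is dense. -/
theorem eq_zero_of_forall_apply_eq_zero {A : Type*} [NonUnitalCStarAlgebra A]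
    {π : A →⋆ₙₐ[ℂ] (H →L[ℂ] H)}
    (hπ : (Submodule.span ℂ {η : H | ∃ a ξ, η = π a ξ}).topologicalClosure = ⊤) {ζ : H}
    (h : ∀ a, π a ζ = 0) : ζ = 0 :=
  eq_zero_of_forall_inner_eq_zero hπ fun a ξ => by
    rw [← ContinuousLinearMap.adjoint_inner_right, ← ContinuousLinearMap.star_eq_adjoint,
      ← map_star, h, inner_zero_right]

/-- A vector `ζ` orthogonal to the range is orthogonal to the image of each `φ ⊗ a`, so `∫ φ(k) ⟪ζ,
π(a) V_k ξ⟫ dk = 0` for all `φ`. The continuous function `k ↦ ⟪ζ, π(a) V_k ξ⟫` therefore vanishes,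
and its value at `k = 1` shows that `ζ` is orthogonal to the range of `π`. -/
theorem nondegenerate_integratedForm {π : A →⋆ₙₐ[ℂ] (H →L[ℂ] H)} {V : UnitaryRep K H}
    (h : IsCovariantRep 1 π V) :
    (Submodule.span ℂ {η : H | ∃ b ξ, η = integratedForm h b ξ}).topologicalClosure = ⊤ := by
  rw [Submodule.topologicalClosure_eq_top_iff, Submodule.eq_bot_iff]
  intro ζ hζ
  refine eq_zero_of_forall_inner_eq_zero h.nondegenerate fun a ξ => ?_
  have hF : Continuous fun k => inner ℂ ζ (π a (V k ξ)) :=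
    continuous_const.inner ((π a).continuous.comp (V.continuous_op ξ))
  have h0 := eq_zero_of_forall_integral_smul_eq_zero (Measure.haar : Measure K) hF
    (fun φ hφ hc => ?_) 1
  · rw [V.map_one] at h0
    exact inner_eq_zero_symm.1 h0
  · have h1 := (Submodule.mem_orthogonal' _ _).1 hζ
      (integratedForm h (CStarCompletion.of (ConvAlg.tensor φ hφ hc a)) ξ)
      (Submodule.subset_span ⟨_, _, rfl⟩)
    rw [integratedForm_of, integratedOp_apply, ← integral_inner (integrable_integrand π V _ ξ)] at h1
    rw [← h1]
    refine integral_congr_ae (Eventually.of_forall fun k => ?_)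
    simp [ConvAlg.tensor, inner_smul_right]

end Representations

/-! ### Characters, modulation and the group algebra -/

section DualPair

variable {G A H : Type*} [CommGroup G] [TopologicalSpace G] [IsTopologicalGroup G]
  [NonUnitalCStarAlgebra A] [NormedAddCommGroup H] [InnerProductSpace ℂ H] [CompleteSpace H]

theorem conj_eq_iff_mul_eq (U : UnitaryRep G H) (g : G) (S T : H →L[ℂ] H) :
    U g * S * star (U g) = T ↔ U g * S = T * U g := by
  have h1 : U g * star (U g) = 1 := Unitary.coe_mul_star_self _
  have h2 : star (U g) * U g = 1 := Unitary.coe_star_mul_self _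
  constructor
  · rintro rfl
    rw [mul_assoc, h2, mul_one]
  · intro h
    rw [h, mul_assoc, h1, mul_one]

variable [LocallyCompactSpace G]

theorem continuous_pairing_uncurry :
    Continuous fun p : PontryaginDual G × G => (p.1 p.2 : ℂ) := by
  have : Continuous fun p : PontryaginDual G × G => p.1 p.2 :=
    (ContinuousEval.continuous_eval (F := G →ₜ* Circle))
  exact continuous_subtype_val.comp this

/-- The dual action on `C_c(G)`: multiplication by the character `γ⁻¹`. -/
noncomputable def ConvAlg.modulate (x : ConvAlg G ℂ) (γ : PontryaginDual G) : ConvAlg G ℂ :=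
  ConvAlg.mk (fun g => ((γ⁻¹ g : Circle) : ℂ) * x g)
    ((continuous_pairing_uncurry.comp (Continuous.prodMk_right γ⁻¹)).mul x.continuous_coe)
    x.hasCompactSupport.mul_left

variable [MeasurableSpace G] [BorelSpace G]

/-- The operator norm is dominated by the `L¹`-norm, and `γ ↦ γ⁻¹ x` is `L¹`-continuous because `x`
has compact support and the pairing is jointly continuous. Norm continuity here is what allows
uniform convergence on the support of `f` in part 2. -/
theorem continuous_integratedOp_modulate (π : ℂ →⋆ₙₐ[ℂ] (H →L[ℂ] H)) (U : UnitaryRep G H)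
    (hU : IsCovariantRep 1 π U) (x : ConvAlg G ℂ) :
    Continuous fun γ => integratedOp π U (x.modulate γ) := by
  rw [continuous_iff_continuousAt]
  intro δ
  have hcont : Continuous fun γ : PontryaginDual G =>
      ∫ g, ‖((γ⁻¹ g : Circle) : ℂ) * x g - ((δ⁻¹ g : Circle) : ℂ) * x g‖
        ∂(Measure.haar : Measure G) := by
    rw [← continuousOn_univ]
    refine continuousOn_integral_of_compact_support (k := tsupport x) x.hasCompactSupport ?_ ?_
    · refine Continuous.continuousOn ?_
      have h1 : Continuous fun p : PontryaginDual G × G => ((p.1⁻¹ p.2 : Circle) : ℂ) :=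
        continuous_pairing_uncurry.comp (continuous_fst.inv.prodMk continuous_snd)
      have h2 : Continuous fun p : PontryaginDual G × G => ((δ⁻¹ p.2 : Circle) : ℂ) :=
        continuous_pairing_uncurry.comp (continuous_const.prodMk continuous_snd)
      have h3 : Continuous fun p : PontryaginDual G × G => x p.2 :=
        x.continuous_coe.comp continuous_snd
      exact ((h1.mul h3).sub (h2.mul h3)).norm
    · intro γ g _ hg
      simp [x.apply_eq_zero hg]
  rw [ContinuousAt, tendsto_iff_norm_sub_tendsto_zero]
  have h0 := hcont.tendsto δ
  simp only [sub_self, norm_zero, integral_zero] at h0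
  refine squeeze_zero (fun _ => norm_nonneg _) (fun γ => ?_) h0
  have e := map_sub (integratedPre hU) (x.modulate γ) (x.modulate δ)
  simp only [integratedPre_apply] at e
  rw [← e]
  refine (norm_integratedOp_le π U _).trans_eq ?_
  refine integral_congr_ae (Eventually.of_forall fun g => ?_)
  simp only [sub_eq_add_neg]
  rfl

/-- The hypothesis reads `W U_g = γ(g)⁻¹ U_g W`; the scalar is absorbed into the integrated
function, which explains the inverse in `ConvAlg.modulate`. -/
theorem apply_integratedOp_scalarRep {U : UnitaryRep G H} {γ : PontryaginDual G} {W : H →L[ℂ] H}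
    (h : ∀ g : G, U g * W = ((γ g : ℂ) • W) * U g) (x : ConvAlg G ℂ) (ξ : H) :
    W (integratedOp (scalarRep H) U x ξ) = integratedOp (scalarRep H) U (x.modulate γ) (W ξ) := by
  rw [integratedOp_apply, integratedOp_apply,
    ← W.integral_comp_comm (integrable_integrand (scalarRep H) U x ξ)]
  refine integral_congr_ae (Eventually.of_forall fun g => ?_)
  have h1 : U g (W ξ) = (γ g : ℂ) • W (U g ξ) := DFunLike.congr_fun (h g) ξ
  have h2 : ((γ⁻¹ g : Circle) : ℂ) * (γ g : ℂ) = 1 := by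
    rw [← Circle.coe_mul, pairing_inv, inv_mul_cancel, Circle.coe_one]
  change W (x g • U g ξ) = (((γ⁻¹ g : Circle) : ℂ) * x g) • U g (W ξ)
  rw [map_smul, h1, smul_smul, mul_right_comm, h2, one_mul]

variable [MeasurableSpace (PontryaginDual G)] [BorelSpace (PontryaginDual G)]

/-! ### Covariance and the commutation relation -/

theorem isCovariantRep_integratedForm {α : G →* (A ≃⋆ₐ[ℂ] A)} {π : A →⋆ₙₐ[ℂ] (H →L[ℂ] H)}
    {U : UnitaryRep G H} (hU : IsCovariantRep α π U) {V : UnitaryRep (PontryaginDual G) H}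
    (hV : IsCovariantRep 1 π V)
    (h : ∀ (g : G) (γ : PontryaginDual G), U g * V γ * star (U g) = (γ g : ℂ) • V γ) :
    IsCovariantRep (dualizedAction α) (integratedForm hV) U where
  nondegenerate := nondegenerate_integratedForm hV
  covariant g b := by
    have hc := continuous_nonUnitalStarAlgHom (integratedForm hV)
    refine CStarCompletion.induction_on b (isClosed_eq
      ((continuous_const.mul hc).mul continuous_const)
      (hc.comp (continuous_twistHom g (α g)))) fun f => ?_
    rw [dualizedAction_of, integratedForm_of, integratedForm_of, conj_eq_iff_mul_eq]
    ext ξ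
    simp only [mul_apply_eq_comp, integratedOp_apply]
    rw [← (U g).integral_comp_comm (integrable_integrand π V f ξ)]
    refine integral_congr_ae (Eventually.of_forall fun γ => ?_)
    have h1 := DFunLike.congr_fun ((conj_eq_iff_mul_eq U g _ _).1 (hU.covariant g (f γ))) (V γ ξ)
    have h2 := DFunLike.congr_fun ((conj_eq_iff_mul_eq U g _ _).1 (h g γ)) ξ
    simp only [mul_apply_eq_comp, smul_apply] at h1 h2
    simp only [twist_apply, map_smul, smul_apply]
    rw [h1, h2, map_smul]

theorem commutation_of_isCovariantRep_integratedForm {α : G →* (A ≃⋆ₐ[ℂ] A)}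
    {π : A →⋆ₙₐ[ℂ] (H →L[ℂ] H)} {U : UnitaryRep G H} (hU : IsCovariantRep α π U)
    {V : UnitaryRep (PontryaginDual G) H} (hV : IsCovariantRep 1 π V)
    (h : IsCovariantRep (dualizedAction α) (integratedForm hV) U) (g : G)
    (γ : PontryaginDual G) : U g * V γ * star (U g) = (γ g : ℂ) • V γ := by
  rw [conj_eq_iff_mul_eq]
  ext ξ
  rw [← sub_eq_zero]
  refine eq_zero_of_forall_apply_eq_zero hU.nondegenerate fun a => ?_
  -- Writing the algebra element as `α g a` makes it the one that appears when `U g` is moved past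
  -- `π a`.
  obtain ⟨a, rfl⟩ := EquivLike.surjective (α g) a
  -- Covariance of the integrated form on `φ ⊗ a` is exactly `∫ φ F = 0`, and covariance of `(π, U)`
  -- identifies `F γ` with `π(α g a)` applied to the commutation defect at `ξ`.
  let F : PontryaginDual G → H := fun γ =>
    U g (π a (V γ ξ)) - (γ g : ℂ) • π (α g a) (V γ (U g ξ))
  have hF₁ : Continuous fun γ => U g (π a (V γ ξ)) :=
    (U g).continuous.comp ((π a).continuous.comp (V.continuous_op ξ))
  have hF₂ : Continuous fun γ : PontryaginDual G => (γ g : ℂ) • π (α g a) (V γ (U g ξ)) :=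
    (continuous_pairing g).smul ((π _).continuous.comp (V.continuous_op _))
  have hF : Continuous F := hF₁.sub hF₂
  have h0 : F γ = 0 := by
    refine eq_zero_of_forall_integral_smul_eq_zero (Measure.haar : Measure (PontryaginDual G)) hF
      (fun φ hφ hc => ?_) γ
    have h1 := DFunLike.congr_fun ((conj_eq_iff_mul_eq U g _ _).1
      (h.covariant g (CStarCompletion.of (ConvAlg.tensor φ hφ hc a)))) ξ
    rw [dualizedAction_of, integratedForm_of, integratedForm_of] at h1
    simp only [mul_apply_eq_comp, integratedOp_apply] at h1
    rw [← (U g).integral_comp_comm (integrable_integrand π V _ ξ), ← sub_eq_zero] at h1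
    have i₁ : Integrable (fun γ => φ γ • U g (π a (V γ ξ)))
        (Measure.haar : Measure (PontryaginDual G)) :=
      (hφ.smul hF₁).integrable_of_hasCompactSupport hc.smul_right
    have i₂ : Integrable (fun γ : PontryaginDual G =>
        φ γ • (γ g : ℂ) • π (α g a) (V γ (U g ξ))) (Measure.haar : Measure (PontryaginDual G)) :=
      (hφ.smul hF₂).integrable_of_hasCompactSupport hc.smul_right
    simp only [F, smul_sub]
    rw [integral_sub i₁ i₂, ← h1]
    congr 1
    · refine integral_congr_ae (Eventually.of_forall fun γ => ?_)
      simp [ConvAlg.tensor]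
    · refine integral_congr_ae (Eventually.of_forall fun γ => ?_)
      simp [ConvAlg.tensor, twist_apply, smul_comm (φ γ)]
  have h2 := DFunLike.congr_fun ((conj_eq_iff_mul_eq U g _ _).1 (hU.covariant g a)) (V γ ξ)
  simp only [mul_apply_eq_comp] at h2
  rw [map_sub, ← h0]
  simp only [F, mul_apply_eq_comp, smul_apply, map_smul]
  rw [h2]

/-! ### The cross property -/

theorem isCross_integratedForm {π : A →⋆ₙₐ[ℂ] (H →L[ℂ] H)} {U : UnitaryRep G H}
    (hcross : IsCross π U) {V : UnitaryRep (PontryaginDual G) H} (hV : IsCovariantRep 1 π V)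
    (h : ∀ (g : G) (γ : PontryaginDual G), U g * V γ * star (U g) = (γ g : ℂ) • V γ) :
    IsCross (integratedForm hV) U := by
  obtain ⟨l, hl, hl1, hlim⟩ := hcross
  refine ⟨l, hl, hl1, fun b x => ?_⟩
  have hP : ∀ᶠ e in l, ‖groupAlgebraRep U e‖ ≤ 1 := hl1.mono fun e he =>
    (NonUnitalStarAlgHom.norm_apply_le (groupAlgebraRep U) e).trans he
  have hcl := isClosed_setOf_tendsto_norm_mul_sub hP
  have hcU := continuous_nonUnitalStarAlgHom (groupAlgebraRep U)
  have hcV := continuous_nonUnitalStarAlgHom (integratedForm hV)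
  -- Reassociating exhibits the condition as `P e * T - T → 0` with `T` a single operator; such `T`
  -- form a norm-closed set, so `b` and `x` may be taken in the dense convolution algebras.
  simp only [mul_assoc] at hlim ⊢
  refine CStarCompletion.induction_on b (hcl.preimage (hcV.mul continuous_const)) fun f => ?_
  refine CStarCompletion.induction_on x (hcl.preimage (continuous_const.mul hcU)) fun x => ?_
  have hUx : ∀ x : ConvAlg G ℂ, groupAlgebraRep U (CStarCompletion.of x)
      = integratedOp (scalarRep H) U x := integratedForm_of _
  refine tendsto_norm_mul_sub_of_integral hP V
    -- For each fixed `γ`, the cross condition is applied to the algebra element `f γ` and the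
    -- modulated function `x.modulate γ`.
    (T := fun γ => π (f γ) * integratedOp (scalarRep H) U (x.modulate γ))
    (((continuous_nonUnitalStarAlgHom π).comp f.continuous_coe).mul
      (continuous_integratedOp_modulate _ _ (isCovariantRep_scalarRep U) x))
    f.hasCompactSupport (fun γ hγ => by simp [f.apply_eq_zero hγ])
    (fun γ => by simpa only [hUx] using hlim (f γ) (CStarCompletion.of (x.modulate γ)))
    fun ξ => ?_
  rw [integratedForm_of, hUx, mul_apply_eq_comp, integratedOp_apply]
  refine integral_congr_ae (Eventually.of_forall fun γ => ?_)
  simp only [mul_apply_eq_comp]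
  rw [apply_integratedOp_scalarRep fun g => (conj_eq_iff_mul_eq U g _ _).1 (h g γ)]

end DualPair

theorem mainTheorem8 {G A H : Type*} [CommGroup G] [TopologicalSpace G] [IsTopologicalGroup G]
    [LocallyCompactSpace G] [T2Space G] [MeasurableSpace G] [BorelSpace G]
    [MeasurableSpace (PontryaginDual G)] [BorelSpace (PontryaginDual G)]
    [NonUnitalCStarAlgebra A]
    [NormedAddCommGroup H] [InnerProductSpace ℂ H] [CompleteSpace H]
    (α : G →* (A ≃⋆ₐ[ℂ] A)) (π : A →⋆ₙₐ[ℂ] (H →L[ℂ] H)) (U : UnitaryRep G H)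
    (hπU : IsCovariantRep α π U) (hcross : IsCross π U)
    (V : UnitaryRep (PontryaginDual G) H) (hπV : IsCovariantRep 1 π V) :
    (IsCovariantRep (dualizedAction α) (integratedForm hπV) U ↔
      ∀ (g : G) (γ : PontryaginDual G), U g * V γ * star (U g) = (γ g : ℂ) • V γ) ∧
    (IsCovariantRep (dualizedAction α) (integratedForm hπV) U →
      IsCross (integratedForm hπV) U) :=
  ⟨⟨commutation_of_isCovariantRep_integratedForm hπU hπV,
    isCovariantRep_integratedForm hπU hπV⟩,
    fun h => isCross_integratedForm hcross hπV
      (commutation_of_isCovariantRep_integratedForm hπU hπV h)⟩
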